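/- Let $K$ be a field of characteristic zero and let $\mathfrak{g}$ be a nilpotent Lie algebra over $K$ of finite dimension $n\ge 1$. Then $\mathfrak{g}$ has a faithful finite-dimensional module $M$ with $$\dim_K M<\frac{3}{\sqrt{n}}\,2^n .$$ Consequently, writing $\mu(\mathfrak{g})$ for the minimal dimension of a faithful $\mathfrak{g}$-module, $$\mu(\mathfrak{g})<\frac{3}{\sqrt{n}}\,2^n .$$ -/

import Mathlib

universe u v

/-- The dimensions of the finite-dimensional faithful modules of a Lie algebra `L` over a field `K`.
A `d`-dimensional module is isomorphic to one on `Fin d → K`, so modules in the universe of `K`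
realise every dimension. -/
def faithfulModuleDims (K : Type u) (L : Type v) [Field K] [LieRing L] [LieAlgebra K L] : Set ℕ :=
  {d | ∃ (M : Type u) (_ : AddCommGroup M) (_ : Module K M) (_ : LieRingModule L M)
      (_ : LieModule K L M),
      LieModule.IsFaithful K L M ∧ Module.Finite K M ∧ Module.finrank K M = d}

/-- The invariant `μ(L)`: the minimal dimension of a faithful `L`-module. -/
noncomputable def faithfulMu (K : Type u) (L : Type v) [Field K] [LieRing L] [LieAlgebra K L] : ℕ :=
  sInf (faithfulModuleDims K L)

-- Let k + 1 be the nilpotency class. Giving the terms of the lower central series the weights 1, 2,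
-- … filters U(L) by J m, the span of products of weight at least m. The module is U(L)/N with J (k
-- + 2) ≤ N ≤ J (k + 1), where N is complementary in J (k + 1) to the part of L lying there. Since L
-- raises weight, N is a left ideal; since x sends 1 to the class of x, the action is faithful. The
-- dimension is at most n plus that of U(L)/J (k + 1), hence at most n plus the number of monomials
-- of weight at most k in an adapted basis.
--
-- Two fragments of Poincaré–Birkhoff–Witt suffice: L meets J (k + 2) trivially
-- (`envι_eq_zero_of_mem_weightFilt`), and ordered monomials span (`exists_weights`). Both go by
-- induction on the dimension, splitting off one vector of least weight.
--
-- The lower central series drops strictly, so the weights dominate 1, …, 1, 2, …, k + 1. The count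
-- is then at most Σ p_j C(n - j, n - k), where p_j counts partitions of j into parts from {2, …, k
-- + 1} (`weightCount_map_range_eq`). Bounding the binomial by 0.8165 · 2^n (7/12)^j / √n and Σ p_j
-- (7/12)^j by 2.7 gives less than 2.21 · 2^n / √n. The summand n costs at most 0.7072 · 2^n / √n,
-- and the total stays below 3 · 2^n / √n.

universe w

attribute [local instance 100] LieRing.ofAssociativeRing

/-! ### Weight filtrations on a Lie algebra and on products of its elements -/

section WeightFiltration

variable {K : Type*} {L : Type*} {A : Type*} [Field K] [LieRing L] [LieAlgebra K L]
  [Ring A] [Algebra K A]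

/-- `WeightedProd ρ F m u` says that `u` is a product `ρ x₁ * ⋯ * ρ xᵣ` with `xₗ ∈ F iₗ` and
`i₁ + ⋯ + iᵣ = m`. -/
inductive WeightedProd (ρ : L →ₗ[K] A) (F : ℕ → Submodule K L) : ℕ → A → Prop
  | one : WeightedProd ρ F 0 1
  | mul {i m : ℕ} {x : L} {u : A} : x ∈ F i → WeightedProd ρ F m u →
      WeightedProd ρ F (i + m) (ρ x * u)

/-- The span of the products of weight at least `m`. -/
def weightFilt (ρ : L →ₗ[K] A) (F : ℕ → Submodule K L) (m : ℕ) : Submodule K A :=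
  Submodule.span K {u | ∃ m', m ≤ m' ∧ WeightedProd ρ F m' u}

variable (ρ : L →ₗ[K] A) (F : ℕ → Submodule K L)

theorem weightFilt_antitone : Antitone (weightFilt ρ F) := fun _ _ h =>
  Submodule.span_mono fun _ ⟨m', hm, hu⟩ => ⟨m', h.trans hm, hu⟩

theorem one_mem_weightFilt : (1 : A) ∈ weightFilt ρ F 0 :=
  Submodule.subset_span ⟨0, le_rfl, .one⟩

variable {ρ F}

theorem mul_mem_weightFilt {i m : ℕ} {x : L} {u : A} (hx : x ∈ F i)
    (hu : u ∈ weightFilt ρ F m) : ρ x * u ∈ weightFilt ρ F (i + m) := by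
  induction hu using Submodule.span_induction with
  | mem u hu =>
    obtain ⟨m', hm, hu⟩ := hu
    exact Submodule.subset_span ⟨i + m', by omega, .mul hx hu⟩
  | zero => simp
  | add a b _ _ ha hb => rw [mul_add]; exact add_mem ha hb
  | smul c a _ ha => rw [mul_smul_comm]; exact Submodule.smul_mem _ _ ha

/-- The induction principle used to compare `weightFilt` with other filtrations. -/
theorem weightFilt_le {W : ℕ → Submodule K A} (hW : Antitone W) (h1 : (1 : A) ∈ W 0)
    (hmul : ∀ i m x u, x ∈ F i → u ∈ W m → ρ x * u ∈ W (i + m)) (m : ℕ) :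
    weightFilt ρ F m ≤ W m := by
  refine Submodule.span_le.2 ?_
  rintro u ⟨m', hm, hu⟩
  refine hW hm ?_
  clear hm
  induction hu with
  | one => exact h1
  | mul hx _ ih => exact hmul _ _ _ _ hx ih

/-- Elements of `weightFilt ρ F m` shift a compatible filtration by `m`. -/
theorem apply_mem_of_mem_weightFilt {V : Type*} [AddCommGroup V] [Module K V]
    (f : A →ₐ[K] Module.End K V) {W : ℕ → Submodule K V} (hW : Antitone W)
    (h : ∀ i j x v, x ∈ F i → v ∈ W j → f (ρ x) v ∈ W (i + j)) {m j : ℕ} {u : A} {v : V}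
    (hu : u ∈ weightFilt ρ F m) (hv : v ∈ W j) : f u v ∈ W (m + j) := by
  let S : ℕ → Submodule K A := fun m =>
    { carrier := {u | ∀ j, ∀ v ∈ W j, f u v ∈ W (m + j)}
      add_mem' := fun {a b} ha hb j v hv => by
        simpa using add_mem (ha j v hv) (hb j v hv)
      zero_mem' := fun j v hv => by simp
      smul_mem' := fun c a ha j v hv => by
        simpa using Submodule.smul_mem _ c (ha j v hv) }
  have hS : weightFilt ρ F m ≤ S m := by
    refine weightFilt_le (W := S) ?_ ?_ ?_ m
    · intro a b hab u hu j v hv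
      exact hW (by omega) (hu j v hv)
    · intro j v hv
      simpa using hv
    · intro i m x u hx hu j v hv
      have := h i (m + j) x _ hx (hu j v hv)
      rw [add_assoc]
      simpa using this
  exact hS hu j v hv

/-- A separated filtration `L = F 1 ≥ F 2 ≥ ⋯ ≥ F (k + 1) = 0` of a Lie algebra. -/
structure IsLieFiltration (F : ℕ → Submodule K L) (k : ℕ) : Prop where
  anti : Antitone F
  one : F 1 = ⊤
  bot : F (k + 1) = ⊥
  lie : ∀ {i j : ℕ} {x y : L}, x ∈ F i → y ∈ F j → ⁅x, y⁆ ∈ F (i + j)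

variable {k : ℕ}

/-- Take s to be the last index with F s = ⊤: then x has the least possible weight, and φ sees
nothing of larger weight. -/
theorem IsLieFiltration.exists_split [Nontrivial L] (hF : IsLieFiltration F k) :
    ∃ (s : ℕ) (x : L) (φ : L →ₗ[K] K), 1 ≤ s ∧ s ≤ k ∧ F s = ⊤ ∧ F (s + 1) ≤ LinearMap.ker φ ∧
      φ x = 1 := by
  classical
  have hex : ∃ m, F (m + 1) ≠ ⊤ := ⟨k, by rw [hF.bot]; exact bot_ne_top⟩
  obtain ⟨s, hs⟩ : ∃ s, Nat.find hex = s := ⟨_, rfl⟩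
  have hs1 : F (s + 1) ≠ ⊤ := hs ▸ Nat.find_spec hex
  have hmin : ∀ m < s, F (m + 1) = ⊤ := fun m hm => not_not.1 (Nat.find_min hex (hs ▸ hm))
  have hs0 : s ≠ 0 := by rintro rfl; exact hs1 hF.one
  obtain ⟨r, rfl⟩ := Nat.exists_eq_succ_of_ne_zero hs0
  have hsk : r + 1 ≤ k := by
    by_contra hlt
    have := hmin k (by omega)
    rw [hF.bot] at this
    exact bot_ne_top this
  obtain ⟨y, hy⟩ : ∃ y, y ∉ F (r + 1 + 1) := by
    by_contra! hall
    exact hs1 (Submodule.eq_top_iff'.2 hall)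
  obtain ⟨φ, hφ, hle⟩ := Submodule.exists_le_ker_of_notMem hy
  refine ⟨r + 1, (φ y)⁻¹ • y, φ, by omega, hsk, hmin r (by omega), hle, ?_⟩
  simp [hφ]

/-- Brackets lie in F (2s) ≤ F (s + 1), so the kernel of φ is an ideal. -/
theorem IsLieFiltration.apply_lie_eq_zero (hF : IsLieFiltration F k) {s : ℕ} {φ : L →ₗ[K] K}
    (hs : 1 ≤ s) (htop : F s = ⊤) (hφ : F (s + 1) ≤ LinearMap.ker φ) (x y : L) :
    φ ⁅x, y⁆ = 0 :=
  hφ (hF.anti (by omega : s + 1 ≤ s + s) (hF.lie (htop ▸ Submodule.mem_top : x ∈ F s)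
    (htop ▸ Submodule.mem_top : y ∈ F s)))

/-- The kernel of a linear form vanishing on brackets, as a Lie subalgebra. -/
def kerLieSubalgebra (φ : L →ₗ[K] K) (h : ∀ x y : L, φ ⁅x, y⁆ = 0) : LieSubalgebra K L :=
  { LinearMap.ker φ with lie_mem' := fun {x y} _ _ => h x y }

theorem IsLieFiltration.comap (hF : IsLieFiltration F k) (S : LieSubalgebra K L) :
    IsLieFiltration (fun i => (F i).comap (S.incl : S →ₗ[K] L)) k where
  anti _ _ h := Submodule.comap_mono (hF.anti h)
  one := by simp [hF.one]
  bot := by ext x; simp [hF.bot]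
  lie hx hy := hF.lie hx hy

theorem weightFilt_comap_le (S : LieSubalgebra K L) (m : ℕ) :
    weightFilt (ρ ∘ₗ (S.incl : S →ₗ[K] L)) (fun i => (F i).comap (S.incl : S →ₗ[K] L)) m ≤
      weightFilt ρ F m := by
  refine weightFilt_le (weightFilt_antitone ρ F) (one_mem_weightFilt ρ F) ?_ m
  intro _ _ x _ hx hu
  exact mul_mem_weightFilt (x := (x : L)) hx hu

theorem pow_mul_mem_weightFilt {s m : ℕ} {x : L} (hx : x ∈ F s) (a : ℕ) {u : A}
    (hu : u ∈ weightFilt ρ F m) : ρ x ^ a * u ∈ weightFilt ρ F (a * s + m) := by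
  induction a with
  | zero => simpa using hu
  | succ a ih =>
    have := mul_mem_weightFilt hx ih
    rw [pow_succ', mul_assoc]
    convert this using 1
    congr 1
    ring

end WeightFiltration

/-! ### The enveloping algebra: derivations and generation -/

section Enveloping

open UniversalEnvelopingAlgebra

variable (K : Type*) {L : Type*} [Field K] [LieRing L] [LieAlgebra K L]

/-- The canonical map into the enveloping algebra, as a linear map. -/
noncomputable def envι : L →ₗ[K] UniversalEnvelopingAlgebra K L :=
  (UniversalEnvelopingAlgebra.ι K : L →ₗ⁅K⁆ UniversalEnvelopingAlgebra K L)

theorem envι_lie (x y : L) : envι K ⁅x, y⁆ = envι K x * envι K y - envι K y * envι K x :=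
  (UniversalEnvelopingAlgebra.ι K).map_lie x y

variable {K}

theorem exists_env_lift {A : Type*} [Ring A] [Algebra K A] (T : L →ₗ[K] A)
    (hT : ∀ x y, T ⁅x, y⁆ = T x * T y - T y * T x) :
    ∃ f : UniversalEnvelopingAlgebra K L →ₐ[K] A, ∀ x, f (envι K x) = T x :=
  ⟨UniversalEnvelopingAlgebra.lift K { T with map_lie' := fun {x y} => hT x y },
    fun x => UniversalEnvelopingAlgebra.lift_ι_apply K _ x⟩

theorem env_algHom_eq {A : Type*} [Ring A] [Algebra K A]
    {f g : UniversalEnvelopingAlgebra K L →ₐ[K] A} (h : ∀ x, f (envι K x) = g (envι K x)) :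
    f = g :=
  UniversalEnvelopingAlgebra.hom_ext K (LieHom.ext h)

/-- A derivation of a Lie algebra extends to its enveloping algebra. -/
theorem exists_env_derivation (δ : L →ₗ[K] L)
    (hδ : ∀ x y, δ ⁅x, y⁆ = ⁅δ x, y⁆ + ⁅x, δ y⁆) :
    ∃ D : UniversalEnvelopingAlgebra K L →ₗ[K] UniversalEnvelopingAlgebra K L, D 1 = 0 ∧
      ∀ x u, D (envι K x * u) = envι K (δ x) * u + envι K x * D u := by
  let U := UniversalEnvelopingAlgebra K L
  -- Dual numbers: x ↦ x + ε δ(x) extends to an algebra map u ↦ u + ε D(u).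
  let T : L →ₗ[K] TrivSqZeroExt U U :=
    (TrivSqZeroExt.inlAlgHom K U U).toLinearMap ∘ₗ envι K +
      (TrivSqZeroExt.inrHom U U).restrictScalars K ∘ₗ envι K ∘ₗ δ
  have hT1 : ∀ x, (T x).fst = envι K x := fun x => by simp [T]
  have hT2 : ∀ x, (T x).snd = envι K (δ x) := fun x => by simp [T]
  obtain ⟨f, hf⟩ := exists_env_lift T (fun x y => by
    ext
    · simp [hT1, envι_lie]
    · simp [hT1, hT2, hδ, envι_lie]
      abel)
  have hfst : (TrivSqZeroExt.fstHom K U U).comp f = AlgHom.id K U :=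
    env_algHom_eq fun x => by
    simp only [AlgHom.comp_apply, hf]
    exact hT1 x
  have hfst' : ∀ u, (f u).fst = u := fun u => DFunLike.congr_fun hfst u
  refine ⟨(TrivSqZeroExt.sndHom U U).restrictScalars K ∘ₗ f.toLinearMap, ?_, ?_⟩
  · simp
  · intro x u
    simp [hf, hfst', hT1, hT2, add_comm]

theorem weightFilt_envι_zero {F : ℕ → Submodule K L} (hF : F 0 = ⊤) :
    weightFilt (envι K) F 0 = ⊤ := by
  let S : Subalgebra K (UniversalEnvelopingAlgebra K L) := Algebra.adjoin K (Set.range (envι K))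
  let T : L →ₗ[K] S := (envι K).codRestrict S.toSubmodule
    (fun x => Algebra.subset_adjoin ⟨x, rfl⟩)
  -- U(L) retracts onto the subalgebra generated by L, and by uniqueness of lifts the composite is
  -- the identity; so L generates U(L).
  obtain ⟨f, hf⟩ := exists_env_lift T (fun x y => Subtype.ext (envι_lie K x y))
  have hid : S.val.comp f = AlgHom.id K _ := env_algHom_eq fun x => by
    simp only [AlgHom.comp_apply, hf, AlgHom.id_apply]
    rfl
  rw [Submodule.eq_top_iff']
  intro u
  have hu : u ∈ S := by
    have h : ((f u : S) : UniversalEnvelopingAlgebra K L) = u := DFunLike.congr_fun hid u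
    exact h ▸ (f u).2
  let W : Submodule K (UniversalEnvelopingAlgebra K L) := weightFilt (envι K) F 0
  have key : ∀ a ∈ S, ∀ w ∈ W, a * w ∈ W := by
    intro a ha
    induction ha using Algebra.adjoin_induction with
    | mem a ha =>
      obtain ⟨x, rfl⟩ := ha
      intro w hw
      exact mul_mem_weightFilt (i := 0) (m := 0) (hF ▸ Submodule.mem_top) hw
    | algebraMap r => intro w hw; rw [← Algebra.smul_def]; exact W.smul_mem r hw
    | add a b _ _ ha hb => intro w hw; rw [add_mul]; exact add_mem (ha w hw) (hb w hw)
    | mul a b _ _ ha hb => intro w hw; rw [mul_assoc]; exact ha _ (hb w hw)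
  simpa using key u hu 1 (one_mem_weightFilt _ _)

end Enveloping

/-! ### The Lie algebra meets the products of high weight trivially -/

section Separated

variable {K : Type*} [Field K]

/-- The component along `ker φ` of the splitting `L = ker φ ⊕ K x`, where `φ x = 1`. -/
def kerProj {L : Type*} [LieRing L] [LieAlgebra K L] (φ : L →ₗ[K] K)
    (h : ∀ x y : L, φ ⁅x, y⁆ = 0) (x : L) (hx : φ x = 1) : L →ₗ[K] kerLieSubalgebra φ h :=
  LinearMap.codRestrict (kerLieSubalgebra φ h).toSubmodule
    (LinearMap.id - φ.smulRight x) (fun z => by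
      change φ _ = 0
      simp [hx])

/-- The restriction of `ad x` to `ker φ`. -/
def kerAd {L : Type*} [LieRing L] [LieAlgebra K L] (φ : L →ₗ[K] K)
    (h : ∀ x y : L, φ ⁅x, y⁆ = 0) (x : L) :
    kerLieSubalgebra φ h →ₗ[K] kerLieSubalgebra φ h :=
  LinearMap.codRestrict (kerLieSubalgebra φ h).toSubmodule
    ((LieAlgebra.ad K L x : L →ₗ[K] L) ∘ₗ ((kerLieSubalgebra φ h).incl : _ →ₗ[K] L))
    (fun _ => h _ _)

theorem finrank_kerLieSubalgebra {L : Type*} [LieRing L] [LieAlgebra K L] [FiniteDimensional K L]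
    (φ : L →ₗ[K] K) (h : ∀ x y : L, φ ⁅x, y⁆ = 0) {x : L} (hx : φ x = 1) :
    Module.finrank K (kerLieSubalgebra φ h) + 1 = Module.finrank K L := by
  have h1 := LinearMap.finrank_range_add_finrank_ker φ
  have h2 : LinearMap.range φ = ⊤ := by
    rw [LinearMap.range_eq_top]
    exact fun c => ⟨c • x, by simp [hx]⟩
  rw [h2, finrank_top, Module.finrank_self] at h1
  have h3 : Module.finrank K (kerLieSubalgebra φ h) = Module.finrank K (LinearMap.ker φ) := rfl
  omega

/-- Induction on the dimension replaces a basis of U(L): filtered representations of L detect first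
φ z, then the component of z in ker φ. -/
theorem envι_eq_zero_of_mem_weightFilt : ∀ (n : ℕ) {L : Type v} [LieRing L] [LieAlgebra K L]
    [FiniteDimensional K L] {F : ℕ → Submodule K L} {k : ℕ} (_ : IsLieFiltration F k)
    (_ : Module.finrank K L = n) {z : L} (_ : envι K z ∈ weightFilt (envι K) F (k + 1)), z = 0 := by
  intro n
  induction n with
  | zero =>
    intro L _ _ _ F k _ hn z _
    have := Module.finrank_zero_iff.1 hn
    exact Subsingleton.elim _ _
  | succ n ih =>
    intro L _ _ _ F k hF hn z hz
    have : Nontrivial L := Module.nontrivial_of_finrank_pos (R := K) (by omega)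
    obtain ⟨s, x, φ, hs, hsk, htop, hle, hx⟩ := hF.exists_split
    have hφ := hF.apply_lie_eq_zero hs htop hle
    have hgt : ∀ {i : ℕ} {y : L}, s < i → y ∈ F i → φ y = 0 := fun hi hy => hle (hF.anti hi hy)
    have hz0 : φ z = 0 := by
      -- The unipotent representation through φ, with basis vectors of weights 0 and s; an element
      -- of weight k + 1 > s must act on it by zero.
      let T : L →ₗ[K] Module.End K (K × K) :=
        φ.smulRight (LinearMap.inr K K K ∘ₗ LinearMap.fst K K K)
      have hT : ∀ y v, T y v = (0, φ y * v.1) := fun y v => by simp [T]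
      obtain ⟨f, hf⟩ := exists_env_lift T (fun a b => by
        ext <;> simp [hT, hφ])
      let W : ℕ → Submodule K (K × K) := fun j =>
        if j = 0 then ⊤ else if j ≤ s then LinearMap.ker (LinearMap.fst K K K) else ⊥
      have hW : Antitone W := by
        intro i j hij
        simp only [W]
        split_ifs <;> first | omega | simp
      have hstep : ∀ i j y v, y ∈ F i → v ∈ W j → f (envι K y) v ∈ W (i + j) := by
        intro i j y v hy hv
        rw [hf, hT]
        by_cases hj : j = 0
        · subst hj
          by_cases hi : i ≤ s
          · simp only [W]
            split_ifs <;> first | omega | simp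
          · rw [hgt (by omega) hy, zero_mul]
            exact zero_mem _
        · have hv1 : v.1 = 0 := by
            have := hW (show 1 ≤ j by omega) hv
            simpa [W, hs] using this
          rw [hv1, mul_zero]
          exact zero_mem _
      have := apply_mem_of_mem_weightFilt f hW hstep hz (j := 0) (v := (1, 0)) (by simp [W])
      rw [hf, hT] at this
      have h2 : ¬ (k + 1 ≤ s) := by omega
      simpa [W, h2] using this
    let L' := kerLieSubalgebra φ hφ
    let U' := UniversalEnvelopingAlgebra K L'
    let p := kerProj φ hφ x hx
    let δ := kerAd φ hφ x
    have hp : ∀ y, (p y : L) = y - φ y • x := fun _ => rfl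
    have hδ : ∀ y, (δ y : L) = ⁅x, (y : L)⁆ := fun _ => rfl
    obtain ⟨D, hD1, hD⟩ := exists_env_derivation δ (fun a b => Subtype.ext (by
      simp [hδ]))
    let F' : ℕ → Submodule K L' := fun i => (F i).comap (L'.incl : L' →ₗ[K] L)
    have hF' : IsLieFiltration F' k := hF.comap L'
    have hxs : x ∈ F s := htop ▸ Submodule.mem_top
    have hDm : ∀ m u, u ∈ weightFilt (envι K) F' m → D u ∈ weightFilt (envι K) F' (m + s) := by
      intro m u hu
      -- The Leibniz rule for D (y * u) involves u as well as D u, so both weights are carried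
      -- through the induction.
      let W : ℕ → Submodule K U' := fun m =>
        (weightFilt (envι K) F' (m + s)).comap D ⊓ weightFilt (envι K) F' m
      have hW : weightFilt (envι K) F' m ≤ W m := by
        refine weightFilt_le (W := W) ?_ ?_ ?_ m
        · intro a b hab
          exact inf_le_inf (Submodule.comap_mono (weightFilt_antitone _ _ (by omega)))
            (weightFilt_antitone _ _ hab)
        · exact ⟨by simp [hD1], one_mem_weightFilt _ _⟩
        · rintro i m y u hy ⟨hu1, hu2⟩
          refine ⟨?_, mul_mem_weightFilt hy hu2⟩
          change D (envι K y * u) ∈ weightFilt (envι K) F' (i + m + s)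
          rw [hD]
          refine add_mem ?_ ?_
          · have : δ y ∈ F' (s + i) := by
              change (δ y : L) ∈ F (s + i)
              rw [hδ]
              exact hF.lie hxs hy
            convert mul_mem_weightFilt this hu2 using 2
            omega
          · rw [add_assoc]
            exact mul_mem_weightFilt hy hu1
      exact (hW hu).1
    -- L acts on U(ker φ): the kernel by left multiplication, x by the derivation extending ad x.
    let T : L →ₗ[K] Module.End K U' := LinearMap.mul K U' ∘ₗ envι K ∘ₗ p + φ.smulRight D
    have hT : ∀ y u, T y u = envι K (p y) * u + φ y • D u := fun y u => by simp [T]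
    have hpl : ∀ a b, p ⁅a, b⁆ = ⁅p a, p b⁆ + φ a • δ (p b) - φ b • δ (p a) := by
      intro a b
      apply Subtype.ext
      change (p ⁅a, b⁆ : L) = ⁅(p a : L), (p b : L)⁆ + φ a • (δ (p b) : L) - φ b • (δ (p a) : L)
      rw [hδ, hδ, hp, hp, hp, hφ]
      simp only [lie_sub, sub_lie, lie_smul, smul_lie, lie_self]
      rw [← lie_skew a x]
      module
    obtain ⟨f, hf⟩ := exists_env_lift T (fun a b => by
      ext u
      simp only [hT, hpl, hφ, map_add, map_sub, map_smul, envι_lie, LinearMap.sub_apply,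
        Module.End.mul_apply, hD]
      simp only [mul_add, add_mul, sub_mul, smul_add, mul_smul_comm, smul_mul_assoc, mul_assoc,
        smul_smul, mul_comm (φ b), zero_smul]
      abel)
    have hstep : ∀ i j y v, y ∈ F i → v ∈ weightFilt (envι K) F' j →
        f (envι K y) v ∈ weightFilt (envι K) F' (i + j) := by
      intro i j y v hy hv
      rw [hf, hT]
      -- If i ≤ s, then x itself lies in F i, so the projection preserves F i; if i > s, the
      -- x-component vanishes.
      by_cases hi : i ≤ s
      · refine add_mem (mul_mem_weightFilt ?_ hv) (Submodule.smul_mem _ _ ?_)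
        · change (p y : L) ∈ F i
          rw [hp]
          exact sub_mem hy (Submodule.smul_mem _ _ (hF.anti hi hxs))
        · exact weightFilt_antitone _ _ (by omega) (hDm _ _ hv)
      · have h0 := hgt (by omega) hy
        rw [h0, zero_smul, add_zero]
        refine mul_mem_weightFilt ?_ hv
        change (p y : L) ∈ F i
        rw [hp, h0, zero_smul, sub_zero]
        exact hy
    -- Acting on 1 returns z itself, now as an element of high weight in U(ker φ).
    have hmem := apply_mem_of_mem_weightFilt f (weightFilt_antitone (envι K) F') hstep hz
      (one_mem_weightFilt _ _)
    rw [hf, hT, hz0, zero_smul, mul_one, add_zero, add_zero] at hmem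
    have hrank : Module.finrank K L' = n := by
      have : Module.finrank K L' + 1 = _ := finrank_kerLieSubalgebra φ hφ hx
      omega
    have := congrArg (Subtype.val) (ih hF' hrank hmem)
    rw [hp, hz0] at this
    simpa using this

end Separated

/-! ### Spanning by monomials and the dimension count -/

section Dimension

variable {K : Type*} [Field K]

/-- The number of monomials of weight at most `m` in variables of the given weights. -/
def weightCount : List ℕ → ℕ → ℕ
  | [], _ => 1
  | w :: ws, m => ∑ a ∈ Finset.range (m / w + 1), weightCount ws (m - a * w)

theorem finrank_finset_sup_le {V ι : Type*} [AddCommGroup V] [Module K V] (s : Finset ι)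
    (p : ι → Submodule K V) (g : ι → ℕ)
    (h : ∀ a ∈ s, FiniteDimensional K (p a) ∧ Module.finrank K (p a) ≤ g a) :
    FiniteDimensional K (s.sup p : Submodule K V) ∧
      Module.finrank K (s.sup p : Submodule K V) ≤ ∑ a ∈ s, g a := by
  classical
  induction s using Finset.induction_on with
  | empty =>
    rw [Finset.sup_empty]
    exact ⟨inferInstance, by simp⟩
  | insert a s ha ih =>
    obtain ⟨h1, h2⟩ := ih fun b hb => h b (Finset.mem_insert_of_mem hb)
    obtain ⟨h3, h4⟩ := h a (Finset.mem_insert_self a s)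
    rw [Finset.sup_insert, Finset.sum_insert ha]
    exact ⟨inferInstance,
      (Submodule.finrank_add_le_finrank_add_finrank _ _).trans (add_le_add h4 h2)⟩

/-- The spanning step of the Poincaré–Birkhoff–Witt theorem for one variable `x` and a
complementary ideal. -/
theorem weightFilt_zero_le_iSup {L A : Type*} [LieRing L] [LieAlgebra K L] [Ring A] [Algebra K A]
    {ρ : L →ₗ[K] A} (hρ : ∀ x y, ρ ⁅x, y⁆ = ρ x * ρ y - ρ y * ρ x) {F : ℕ → Submodule K L}
    (hF : F 0 = ⊤) (φ : L →ₗ[K] K) (h : ∀ x y : L, φ ⁅x, y⁆ = 0) {x : L} (hx : φ x = 1) :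
    weightFilt ρ F 0 ≤ ⨆ a : ℕ,
      (weightFilt (ρ ∘ₗ ((kerLieSubalgebra φ h).incl : kerLieSubalgebra φ h →ₗ[K] L))
        (fun i => (F i).comap ((kerLieSubalgebra φ h).incl : kerLieSubalgebra φ h →ₗ[K] L)) 0).map
          (LinearMap.mulLeft K (ρ x ^ a)) := by
  set S := weightFilt (ρ ∘ₗ ((kerLieSubalgebra φ h).incl : kerLieSubalgebra φ h →ₗ[K] L))
        (fun i => (F i).comap ((kerLieSubalgebra φ h).incl : kerLieSubalgebra φ h →ₗ[K] L)) 0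
    with hS
  have hS1 : (1 : A) ∈ S := one_mem_weightFilt _ _
  set T : Submodule K A := ⨆ a : ℕ, S.map (LinearMap.mulLeft K (ρ x ^ a)) with hT
  have hmem : ∀ a u, u ∈ S → ρ x ^ a * u ∈ T := fun a u hu =>
    Submodule.mem_iSup_of_mem a ⟨u, hu, rfl⟩
  have hker : ∀ y : L, φ y = 0 → ∀ u ∈ S, ρ y * u ∈ S := by
    intro y hy u hu
    have hy0 : (⟨y, hy⟩ : kerLieSubalgebra φ h) ∈
        (F 0).comap ((kerLieSubalgebra φ h).incl : kerLieSubalgebra φ h →ₗ[K] L) := by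
      rw [hF]; exact Submodule.mem_top
    exact mul_mem_weightFilt
      (ρ := ρ ∘ₗ ((kerLieSubalgebra φ h).incl : kerLieSubalgebra φ h →ₗ[K] L))
      (F := fun i => (F i).comap ((kerLieSubalgebra φ h).incl : kerLieSubalgebra φ h →ₗ[K] L))
      (i := 0) (m := 0) hy0 hu
  clear_value S
  have hxT : ∀ t ∈ T, ρ x * t ∈ T := by
    intro t ht
    induction ht using Submodule.iSup_induction' with
    | mem a t ht =>
      obtain ⟨u, hu, rfl⟩ := ht
      have := hmem (a + 1) u hu
      rwa [pow_succ', mul_assoc] at this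
    | zero => simp
    | add a b _ _ ha hb => rw [mul_add]; exact add_mem ha hb
  -- Moving y past one factor x costs ⁅y, x⁆, which is again in ker φ and faces one power fewer.
  have hyT : ∀ (a : ℕ) (y : L), φ y = 0 → ∀ u ∈ S, ρ y * (ρ x ^ a * u) ∈ T := by
    intro a
    induction a with
    | zero =>
      intro y hy u hu
      have := hmem 0 _ (hker y hy u hu)
      simpa using this
    | succ a ih =>
      intro y hy u hu
      have h1 := hxT _ (ih y hy u hu)
      have h2 := ih ⁅y, x⁆ (h y x) u hu
      have : ρ y * (ρ x ^ (a + 1) * u) =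
          ρ x * (ρ y * (ρ x ^ a * u)) + ρ ⁅y, x⁆ * (ρ x ^ a * u) := by
        rw [hρ, pow_succ']
        noncomm_ring
      rw [this]
      exact add_mem h1 h2
  refine weightFilt_le (W := fun _ => T) antitone_const ?_ ?_ 0
  · simpa using hmem 0 1 hS1
  · intro i m z t _ ht
    have hz : ρ z = ρ (z - φ z • x) + φ z • ρ x := by simp
    rw [hz, add_mul, smul_mul_assoc]
    refine add_mem ?_ (T.smul_mem _ (hxT t ht))
    have hz0 : φ (z - φ z • x) = 0 := by simp [hx]
    induction ht using Submodule.iSup_induction' with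
    | mem a t ht =>
      obtain ⟨u, hu, rfl⟩ := ht
      exact hyT a _ hz0 u hu
    | zero => simp
    | add a b _ _ ha hb => rw [mul_add]; exact add_mem ha hb

/-- A filtered Lie algebra has weights `ws`, one for each basis vector, such that the products of
weight at most `m` are spanned by as many vectors as there are monomials of weight at most `m`. -/
theorem exists_weights : ∀ (n : ℕ) {L : Type v} [LieRing L] [LieAlgebra K L]
    [FiniteDimensional K L] {F : ℕ → Submodule K L} {k : ℕ} (_ : IsLieFiltration F k)
    (_ : Module.finrank K L = n), ∃ ws : List ℕ, ws.length = n ∧ ws.Pairwise (· ≤ ·) ∧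
      (∀ s, F s = ⊤ → ∀ w ∈ ws, s ≤ w) ∧
      (∀ j, Module.finrank K (F j) ≤ ws.countP (j ≤ ·)) ∧
      ∀ {A V : Type w} [Ring A] [Algebra K A] [AddCommGroup V] [Module K V] (ρ : L →ₗ[K] A)
        (_ : ∀ x y, ρ ⁅x, y⁆ = ρ x * ρ y - ρ y * ρ x) (c : A →ₗ[K] V) (m : ℕ)
        (_ : weightFilt ρ F (m + 1) ≤ LinearMap.ker c),
        FiniteDimensional K ((weightFilt ρ F 0).map c) ∧
          Module.finrank K ((weightFilt ρ F 0).map c) ≤ weightCount ws m := by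
  intro n
  induction n with
  | zero =>
    intro L _ _ _ F k _ hn
    have := Module.finrank_zero_iff.1 hn
    refine ⟨[], rfl, .nil, by simp, fun j => ?_, ?_⟩
    · exact (Submodule.finrank_le _).trans hn.le
    · intro A V _ _ _ _ ρ _ c m _
      have hle : (weightFilt ρ F 0).map c ≤ Submodule.span K {c 1} := by
        rw [Submodule.map_le_iff_le_comap]
        refine weightFilt_le (W := fun _ => (Submodule.span K {c 1}).comap c) antitone_const
          (Submodule.mem_span_singleton_self _) ?_ 0
        intro i m x u _ _
        rw [Subsingleton.elim x 0]
        simp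
      refine ⟨Submodule.finiteDimensional_of_le hle, (Submodule.finrank_mono hle).trans ?_⟩
      exact (finrank_span_le_card _).trans (by simp [weightCount])
  | succ n ih =>
    intro L _ _ _ F k hF hn
    have : Nontrivial L := Module.nontrivial_of_finrank_pos (R := K) (by omega)
    obtain ⟨s, x, φ, hs, hsk, htop, hle, hx⟩ := hF.exists_split
    have hφ := hF.apply_lie_eq_zero hs htop hle
    let L' := kerLieSubalgebra φ hφ
    let F' : ℕ → Submodule K L' := fun i => (F i).comap (L'.incl : L' →ₗ[K] L)
    have hF' : IsLieFiltration F' k := hF.comap L'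
    have hrank : Module.finrank K L' = n := by
      have : Module.finrank K L' + 1 = _ := finrank_kerLieSubalgebra φ hφ hx
      omega
    have hxs : x ∈ F s := htop ▸ Submodule.mem_top
    have hF0 : F 0 = ⊤ := top_le_iff.1 (hF.one ▸ hF.anti (Nat.zero_le 1))
    have hlt : ∀ r, F r = ⊤ → r ≤ s := by
      intro r hr
      by_contra hrs
      have : x ∈ F (s + 1) := hF.anti (by omega) (hr ▸ Submodule.mem_top : x ∈ F r)
      have := hle this
      rw [LinearMap.mem_ker, hx] at this
      exact one_ne_zero this
    obtain ⟨ws, hlen, hsort, hmin, hcount, hdim⟩ := ih hF' hrank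
    have hge : ∀ w ∈ ws, s ≤ w := hmin s (by
      simp only [F', htop, Submodule.comap_top])
    refine ⟨s :: ws, by simp [hlen], List.pairwise_cons.2 ⟨hge, hsort⟩, ?_, ?_, ?_⟩
    · intro r hr w hw
      have := hlt r hr
      rcases List.mem_cons.1 hw with rfl | hw
      · exact this
      · exact this.trans (hge w hw)
    · intro j
      by_cases hj : j ≤ s
      · have : (s :: ws).countP (j ≤ ·) = n + 1 := by
          rw [← hlen, ← List.length_cons (a := s), List.countP_eq_length]
          intro w hw
          rcases List.mem_cons.1 hw with rfl | hw
          · simpa using hj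
          · simpa using hj.trans (hge w hw)
        rw [this, ← hn]
        exact Submodule.finrank_le _
      · have hjs : F j ≤ LinearMap.ker φ := (hF.anti (by omega)).trans hle
        have h1 : Module.finrank K (F j) ≤ Module.finrank K (F' j) := by
          let g : F j →ₗ[K] F' j := LinearMap.codRestrict _
            (LinearMap.codRestrict L'.toSubmodule (F j).subtype (fun y => hjs y.2))
            (fun y => y.2)
          refine LinearMap.finrank_le_finrank_of_injective (f := g) ?_
          intro a b hab
          have := congrArg (fun t : F' j => ((t : L') : L)) hab
          exact Subtype.ext this
        refine h1.trans ((hcount j).trans ?_)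
        rw [List.countP_cons]
        omega
    · intro A V _ _ _ _ ρ hρ c m hc
      -- The arbitrary ρ and c serve the induction: ρ restricts to the ideal, still with values in
      -- A, and c becomes u ↦ c (x^a u), which kills weights above m - a s. Powers with a s > m
      -- contribute nothing.
      let ρ' : L' →ₗ[K] A := ρ ∘ₗ (L'.incl : L' →ₗ[K] L)
      let q : ℕ → Submodule K V := fun a =>
        (weightFilt ρ' F' 0).map (c ∘ₗ LinearMap.mulLeft K (ρ x ^ a))
      have hq : (weightFilt ρ F 0).map c ≤ (Finset.range (m / s + 1)).sup q := by
        refine (Submodule.map_mono (weightFilt_zero_le_iSup hρ hF0 φ hφ hx)).trans ?_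
        rw [Submodule.map_iSup]
        refine iSup_le fun a => ?_
        by_cases ha : a ∈ Finset.range (m / s + 1)
        · rw [← Submodule.map_comp]
          exact Finset.le_sup (f := q) ha
        · have ha' : m + 1 ≤ a * s := by
            rw [Finset.mem_range, not_lt, Nat.succ_le_iff, Nat.div_lt_iff_lt_mul hs] at ha
            exact ha
          rintro _ ⟨_, ⟨u, hu, rfl⟩, rfl⟩
          have hu' : u ∈ weightFilt ρ F 0 := weightFilt_comap_le L' 0 hu
          have := hc (weightFilt_antitone ρ F (by omega) (pow_mul_mem_weightFilt hxs a hu'))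
          rw [LinearMap.mem_ker] at this
          simp [this]
      have hfin := finrank_finset_sup_le (Finset.range (m / s + 1)) q
        (fun a => weightCount ws (m - a * s)) (fun a ha => by
          have ha' : a * s ≤ m := by
            rw [Finset.mem_range, Nat.lt_succ_iff, Nat.le_div_iff_mul_le hs] at ha
            exact ha
          refine hdim ρ' (fun _ _ => hρ _ _) _ (m - a * s) ?_
          intro u hu
          have hu' : u ∈ weightFilt ρ F (m - a * s + 1) := weightFilt_comap_le L' _ hu
          exact hc (weightFilt_antitone ρ F (by omega) (pow_mul_mem_weightFilt hxs a hu')))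
      have := hfin.1
      exact ⟨Submodule.finiteDimensional_of_le hq, (Submodule.finrank_mono hq).trans hfin.2⟩

end Dimension

/-! ### The faithful quotient of the enveloping algebra -/

section Module

theorem exists_lieModule_of_rep {K : Type u} {L : Type v} {Q : Type w} [Field K] [LieRing L]
    [LieAlgebra K L] [AddCommGroup Q] [Module K Q] [FiniteDimensional K Q]
    (T : L →ₗ[K] Module.End K Q) (hT : ∀ x y, T ⁅x, y⁆ = T x * T y - T y * T x)
    (hinj : ∀ x, T x = 0 → x = 0) :
    ∃ (M : Type u) (_ : AddCommGroup M) (_ : Module K M) (_ : LieRingModule L M)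
      (_ : LieModule K L M),
      LieModule.IsFaithful K L M ∧ Module.Finite K M ∧
        Module.finrank K M = Module.finrank K Q := by
  let b : Q ≃ₗ[K] (Fin (Module.finrank K Q) → K) := (Module.finBasis K Q).equivFun
  let i1 : LieRingModule L (Fin (Module.finrank K Q) → K) :=
    { bracket := fun x v => b (T x (b.symm v))
      add_lie := fun x y v => by simp
      lie_add := fun x v w => by simp
      leibniz_lie := fun x y v => by simp [hT] }
  have hbr : ∀ (x : L) (v : Fin (Module.finrank K Q) → K), ⁅x, v⁆ = b (T x (b.symm v)) :=
    fun _ _ => rfl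
  have i2 : LieModule K L (Fin (Module.finrank K Q) → K) :=
    { smul_lie := fun c x v => by simp [hbr]
      lie_smul := fun c x v => by simp [hbr] }
  refine ⟨Fin (Module.finrank K Q) → K, inferInstance, inferInstance, i1, i2, ⟨?_⟩,
    inferInstance, by simp⟩
  rw [injective_iff_map_eq_zero]
  intro x hx
  refine hinj x (LinearMap.ext fun q => ?_)
  have := DFunLike.congr_fun hx (b q)
  rw [LieModule.toEnd_apply_apply, hbr] at this
  simpa using this

variable {K : Type u} {L : Type v} [Field K] [LieRing L] [LieAlgebra K L]

/-- Left multiplication by `L` on a quotient of the enveloping algebra. -/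
theorem exists_rep_quotient (N : Submodule K (UniversalEnvelopingAlgebra K L))
    (hN : ∀ x : L, ∀ u ∈ N, envι K x * u ∈ N) :
    ∃ T : L →ₗ[K] Module.End K (UniversalEnvelopingAlgebra K L ⧸ N),
      ∀ x u, T x (N.mkQ u) = N.mkQ (envι K x * u) := by
  refine ⟨{ toFun := fun x => N.mapQ N (LinearMap.mulLeft K (envι K x)) (hN x)
            map_add' := fun x y => ?_
            map_smul' := fun c x => ?_ }, fun x u => ?_⟩
  · refine Submodule.linearMap_qext _ (LinearMap.ext fun u => ?_)
    simp [add_mul]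
    rfl
  · refine Submodule.linearMap_qext _ (LinearMap.ext fun u => ?_)
    simp
    rfl
  · rfl

/-- Intersect with Q a complement of R containing P; the modular law does the rest. -/
theorem exists_submodule_between {V : Type*} [AddCommGroup V] [Module K V]
    {P Q R : Submodule K V} (hPQ : P ≤ Q) (hRQ : R ≤ Q) (hPR : Disjoint P R) :
    ∃ N, P ≤ N ∧ N ≤ Q ∧ Disjoint N R ∧ Q ≤ N ⊔ R := by
  obtain ⟨C, hPC, hC⟩ := hPR.exists_isCompl
  refine ⟨C ⊓ Q, le_inf hPC hPQ, inf_le_right, hC.disjoint.mono_left inf_le_left, ?_⟩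
  intro q hq
  obtain ⟨c, hc, r, hr, rfl⟩ := Submodule.mem_sup.1 (hC.sup_eq_top ▸ Submodule.mem_top : q ∈ C ⊔ R)
  refine Submodule.add_mem_sup ⟨hc, ?_⟩ hr
  have := sub_mem hq (hRQ hr)
  simpa using this

/-- A filtered Lie algebra of dimension `n` has a faithful module of dimension at most `n` plus the
number of monomials of weight at most `k` in variables whose weights are those of an adapted
basis. -/
theorem exists_faithful_module [FiniteDimensional K L] {F : ℕ → Submodule K L} {k : ℕ}
    (hF : IsLieFiltration F (k + 1)) :
    ∃ ws : List ℕ, ws.length = Module.finrank K L ∧ ws.Pairwise (· ≤ ·) ∧ (∀ w ∈ ws, 1 ≤ w) ∧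
      (∀ j, Module.finrank K (F j) ≤ ws.countP (j ≤ ·)) ∧
      ∃ (M : Type u) (_ : AddCommGroup M) (_ : Module K M) (_ : LieRingModule L M)
        (_ : LieModule K L M), LieModule.IsFaithful K L M ∧ Module.Finite K M ∧
          Module.finrank K M ≤ weightCount ws k + Module.finrank K L := by
  obtain ⟨ws, hlen, hsort, hmin, hcount, hdim⟩ := exists_weights.{v, max u v} _ hF rfl
  refine ⟨ws, hlen, hsort, hmin 1 hF.one, hcount, ?_⟩
  have hF0 : F 0 = ⊤ := top_le_iff.1 (hF.one ▸ hF.anti (Nat.zero_le 1))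
  let J := weightFilt (envι K) F
  have hJ : Antitone J := weightFilt_antitone (envι K) F
  -- Any subspace between J (k + 2) and J (k + 1) is a left ideal, so N can be chosen by linear
  -- algebra alone to avoid L.
  obtain ⟨N, hPN, hNQ, hNR, hQ⟩ := exists_submodule_between (P := J (k + 2)) (Q := J (k + 1))
    (R := LinearMap.range (envι K) ⊓ J (k + 1)) (hJ (by omega)) inf_le_right (by
      rw [Submodule.disjoint_def]
      rintro _ h1 ⟨⟨x, rfl⟩, -⟩
      rw [envι_eq_zero_of_mem_weightFilt _ hF rfl h1, map_zero])
  obtain ⟨T, hT⟩ := exists_rep_quotient N (fun x u hu => by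
    refine hPN ?_
    have hx : x ∈ F 1 := hF.one ▸ Submodule.mem_top
    have := mul_mem_weightFilt hx (hNQ hu)
    rwa [add_comm] at this)
  have hinj : ∀ x, T x = 0 → x = 0 := by
    intro x hx
    have h1 := hT x 1
    rw [hx, LinearMap.zero_apply, mul_one, eq_comm, Submodule.mkQ_apply,
      Submodule.Quotient.mk_eq_zero] at h1
    have h2 : envι K x = 0 := Submodule.disjoint_def.1 hNR _ h1 ⟨⟨x, rfl⟩, hNQ h1⟩
    exact envι_eq_zero_of_mem_weightFilt _ hF rfl (h2 ▸ zero_mem _)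
  obtain ⟨hfin, hrank⟩ := hdim (envι K) (envι_lie K) (J (k + 1)).mkQ k
    (Submodule.ker_mkQ _).ge
  rw [weightFilt_envι_zero hF0] at hfin hrank
  let g := Submodule.factor hNQ
  have hrange : LinearMap.range g = (⊤ : Submodule K _).map (J (k + 1)).mkQ := by
    rw [Submodule.map_top, Submodule.range_mkQ, LinearMap.range_eq_top]
    exact Submodule.factor_surjective hNQ
  -- The kernel is J (k + 1) / N, covered by the image of L; this accounts for the summand n.
  have hker : LinearMap.ker g ≤ LinearMap.range (N.mkQ ∘ₗ envι K) := by
    intro y hy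
    obtain ⟨u, rfl⟩ := N.mkQ_surjective y
    have hu : u ∈ J (k + 1) := by
      rw [LinearMap.mem_ker] at hy
      exact (Submodule.Quotient.mk_eq_zero _).1 hy
    obtain ⟨a, ha, _, ⟨⟨x, rfl⟩, -⟩, rfl⟩ := Submodule.mem_sup.1 (hQ hu)
    refine ⟨x, ?_⟩
    have : N.mkQ a = 0 := (Submodule.Quotient.mk_eq_zero _).2 ha
    rw [map_add, this, zero_add]
    rfl
  have : FiniteDimensional K (LinearMap.ker g) := Submodule.finiteDimensional_of_le hker
  have : FiniteDimensional K (LinearMap.range g) := hrange ▸ hfin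
  have : FiniteDimensional K (UniversalEnvelopingAlgebra K L ⧸ N) := by
    refine ⟨Submodule.fg_of_fg_map_of_fg_inf_ker g ?_ ?_⟩
    · rw [Submodule.map_top]
      exact Module.Finite.iff_fg.1 inferInstance
    · rw [top_inf_eq]
      exact Module.Finite.iff_fg.1 inferInstance
  have hle : Module.finrank K (UniversalEnvelopingAlgebra K L ⧸ N) ≤
      weightCount ws k + Module.finrank K L := by
    rw [← LinearMap.finrank_range_add_finrank_ker g]
    refine add_le_add ?_ ((Submodule.finrank_mono hker).trans (LinearMap.finrank_range_le _))
    rw [hrange]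
    exact hrank
  obtain ⟨M, i1, i2, i3, i4, h1, h2, h3⟩ := exists_lieModule_of_rep T (fun x y => by
    refine Submodule.linearMap_qext _ (LinearMap.ext fun u => ?_)
    simp only [LinearMap.comp_apply, hT, LinearMap.sub_apply, Module.End.mul_apply, envι_lie,
      sub_mul, mul_assoc, map_sub]) hinj
  exact ⟨M, i1, i2, i3, i4, h1, h2, h3.trans_le hle⟩

end Module

/-! ### The lower central series as a filtration -/

section LowerCentralSeries

open LieModule

variable {K : Type u} {L : Type v} [Field K] [LieRing L] [LieAlgebra K L]

theorem lie_mem_lowerCentralSeries_add (i : ℕ) : ∀ (j : ℕ) {x y : L},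
    x ∈ lowerCentralSeries K L L i → y ∈ lowerCentralSeries K L L j →
      ⁅x, y⁆ ∈ lowerCentralSeries K L L (i + j + 1) := by
  induction i with
  | zero =>
    intro j x y _ hy
    rw [zero_add, lowerCentralSeries_succ]
    exact LieSubmodule.lie_mem_lie (LieSubmodule.mem_top x) hy
  | succ i ih =>
    intro j x y hx hy
    rw [lowerCentralSeries_succ, ← LieSubmodule.mem_toSubmodule,
      LieSubmodule.lieIdeal_oper_eq_linear_span'] at hx
    induction hx using Submodule.span_induction with
    | mem x hx =>
      obtain ⟨a, -, b, hb, rfl⟩ := hx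
      -- Jacobi: ⁅⁅a, b⁆, y⁆ = ⁅a, ⁅b, y⁆⁆ - ⁅b, ⁅a, y⁆⁆, with b one step shallower.
      rw [lie_lie]
      refine sub_mem ?_ ?_
      · have := LieSubmodule.lie_mem_lie (LieSubmodule.mem_top (R := K) (L := L) (M := L) a)
          (ih j hb hy)
        rw [← lowerCentralSeries_succ] at this
        convert this using 2
        omega
      · have h1 := LieSubmodule.lie_mem_lie (LieSubmodule.mem_top (R := K) (L := L) (M := L) a) hy
        rw [← lowerCentralSeries_succ] at h1
        convert ih (j + 1) hb h1 using 2
        omega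
    | zero => simp
    | add a b _ _ ha hb => rw [add_lie]; exact add_mem ha hb
    | smul c a _ ha => rw [smul_lie]; exact SMulMemClass.smul_mem c ha

/-- The series is indexed from 0 and weights from 1; truncated subtraction makes F 0 = F 1 = ⊤. -/
theorem isLieFiltration_lowerCentralSeries {k : ℕ} (hk : lowerCentralSeries K L L k = ⊥) :
    IsLieFiltration (fun i => (lowerCentralSeries K L L (i - 1)).toSubmodule) k where
  anti _ _ h := antitone_lowerCentralSeries K L L (by omega)
  one := by simp
  bot := by simp [hk]
  lie {i j x y} hx hy := by
    have := lie_mem_lowerCentralSeries_add (i - 1) (j - 1) hx hy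
    exact antitone_lowerCentralSeries K L L (by omega : i + j - 1 ≤ _) this

/-- Two equal consecutive terms would make the series stationary, so each step before zero loses a
dimension. -/
theorem le_finrank_lowerCentralSeries [FiniteDimensional K L] {k : ℕ}
    (hk : lowerCentralSeries K L L (k + 1) = ⊥) (hk' : lowerCentralSeries K L L k ≠ ⊥) :
    ∀ i, k + 1 - i ≤ Module.finrank K (lowerCentralSeries K L L i) := by
  have hlt : ∀ i, i ≤ k → lowerCentralSeries K L L (i + 1) < lowerCentralSeries K L L i := by
    intro i hi
    refine lt_of_le_of_ne (antitone_lowerCentralSeries K L L (Nat.le_succ i)) fun heq => ?_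
    have hconst : ∀ d, lowerCentralSeries K L L (i + d) = lowerCentralSeries K L L i := by
      intro d
      induction d with
      | zero => rfl
      | succ d ih => rw [← add_assoc, lowerCentralSeries_succ, ih, ← lowerCentralSeries_succ, heq]
    have h1 := hconst (k - i)
    have h2 := hconst (k + 1 - i)
    rw [show i + (k - i) = k by omega] at h1
    rw [show i + (k + 1 - i) = k + 1 by omega] at h2
    exact hk' (h1.trans (h2.symm.trans hk))
  suffices h : ∀ d i, d = k + 1 - i →
      d ≤ Module.finrank K (lowerCentralSeries K L L i) from fun i => h _ i rfl
  intro d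
  induction d with
  | zero => intro i _; exact Nat.zero_le _
  | succ d ih =>
    intro i hi
    have h1 := ih (i + 1) (by omega)
    have h2 := Submodule.finrank_lt_finrank_of_lt
      (s := (lowerCentralSeries K L L (i + 1)).toSubmodule)
      (t := (lowerCentralSeries K L L i).toSubmodule) (hlt i (by omega))
    exact Nat.succ_le_of_lt (lt_of_le_of_lt h1 h2)

end LowerCentralSeries

/-! ### Counting monomials by generating functions -/

section Counting

theorem weightCount_mono_right (ws : List ℕ) : Monotone (weightCount ws) := by
  induction ws with
  | nil => exact monotone_const
  | cons w ws ih =>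
    intro m m' h
    refine (Finset.sum_le_sum fun a _ => ih (Nat.sub_le_sub_right h _)).trans ?_
    exact Finset.sum_le_sum_of_subset (Finset.range_mono
      (Nat.succ_le_succ (Nat.div_le_div_right h)))

theorem weightCount_le_of_forall₂ {ws ws' : List ℕ}
    (h : List.Forall₂ (fun w w' => 1 ≤ w' ∧ w' ≤ w) ws ws') (m : ℕ) :
    weightCount ws m ≤ weightCount ws' m := by
  induction h generalizing m with
  | nil => exact le_rfl
  | @cons w w' ws ws' hw _ ih =>
    refine (Finset.sum_le_sum fun a _ => (ih _).trans (weightCount_mono_right ws'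
      (Nat.sub_le_sub_left (Nat.mul_le_mul_left a hw.2) m))).trans ?_
    exact Finset.sum_le_sum_of_subset (Finset.range_mono
      (Nat.succ_le_succ (Nat.div_le_div_left hw.2 hw.1)))

/-- If a sorted list has at least `k + 1 - j` entries that are at least `j`, then its entries
dominate `1, …, 1, 2, …, k`. -/
theorem forall₂_of_countP {ws : List ℕ} (hsort : ws.Pairwise (· ≤ ·)) (h1 : ∀ w ∈ ws, 1 ≤ w) {k : ℕ}
    (hcount : ∀ j, 1 ≤ j → k + 1 - j ≤ ws.countP (j ≤ ·)) :
    List.Forall₂ (fun w w' => 1 ≤ w' ∧ w' ≤ w) ws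
      ((List.range ws.length).map fun i => max 1 (i + 1 + k - ws.length)) := by
  rw [List.forall₂_iff_get]
  refine ⟨by simp, fun i hi hi' => ?_⟩
  simp only [List.get_eq_getElem, List.getElem_map, List.getElem_range]
  refine ⟨le_max_left _ _, max_le (h1 _ (List.getElem_mem hi)) ?_⟩
  by_contra! hlt
  -- If entry i were below j, so would be all earlier ones, leaving at most n - i - 1 entries that
  -- are at least j; but k + 1 - j = n - i are required.
  set j := i + 1 + k - ws.length with hj
  have hc := hcount j (by omega)
  rw [← List.take_append_drop (i + 1) ws, List.countP_append] at hc
  have htake : (ws.take (i + 1)).countP (j ≤ ·) = 0 := by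
    rw [List.countP_eq_zero]
    intro w hw
    obtain ⟨l, hl, rfl⟩ := List.mem_iff_getElem.1 hw
    rw [List.getElem_take]
    have hl' : l ≤ i := by
      rw [List.length_take] at hl
      omega
    have hle : ws[l]'(by omega) ≤ ws[i] := by
      rcases hl'.eq_or_lt with rfl | hlt
      · exact le_rfl
      · exact List.pairwise_iff_getElem.1 hsort l i (by omega) hi hlt
    simp only [decide_eq_true_eq]
    omega
  have hdrop : (ws.drop (i + 1)).countP (j ≤ ·) ≤ ws.length - (i + 1) := by
    rw [← List.length_drop]
    exact List.countP_le_length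
  omega

open PowerSeries

/-- The geometric series `1 / (1 - X ^ w)`. -/
noncomputable def geomSeries (w : ℕ) : PowerSeries ℝ := mk fun n => if w ∣ n then 1 else 0

theorem geomSeries_eq {w : ℕ} (hw : 1 ≤ w) : geomSeries w = 1 + X ^ w * geomSeries w := by
  ext n
  rw [map_add, coeff_X_pow_mul', coeff_one]
  simp only [geomSeries, coeff_mk]
  by_cases hn : w ≤ n
  · have h0 : n ≠ 0 := by omega
    simp [hn, h0, (Nat.dvd_sub_iff_left hn (dvd_refl w))]
  · have : w ∣ n ↔ n = 0 := ⟨fun h => by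
      by_contra h0
      exact hn (Nat.le_of_dvd (Nat.pos_of_ne_zero h0) h), fun h => h ▸ dvd_zero w⟩
    simp [hn, this]

theorem coeff_geomSeries_mul {w : ℕ} (hw : 1 ≤ w) (P : PowerSeries ℝ) (m : ℕ) :
    coeff m (geomSeries w * P) = ∑ a ∈ Finset.range (m / w + 1), coeff (m - a * w) P := by
  induction m using Nat.strong_induction_on with
  | _ m ih =>
    have h : geomSeries w * P = P + X ^ w * (geomSeries w * P) := by
      conv_lhs => rw [geomSeries_eq hw]
      ring
    rw [h, map_add, coeff_X_pow_mul', Finset.sum_range_succ']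
    split_ifs with hwm
    · rw [ih (m - w) (by omega), Nat.div_eq_sub_div (by omega) hwm, add_comm]
      simp only [zero_mul, Nat.sub_zero, add_left_inj]
      refine Finset.sum_congr rfl fun a _ => ?_
      rw [Nat.sub_sub, add_one_mul, add_comm w]
    · rw [Nat.div_eq_of_lt (by omega)]
      simp

/-- The extra factor 1 / (1 - X) turns weight exactly m into weight at most m. -/
theorem weightCount_eq_coeff {ws : List ℕ} (h : ∀ w ∈ ws, 1 ≤ w) (m : ℕ) :
    (weightCount ws m : ℝ) = coeff m (geomSeries 1 * (ws.map geomSeries).prod) := by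
  induction ws generalizing m with
  | nil => simp [weightCount, geomSeries]
  | cons w ws ih =>
    rw [List.map_cons, List.prod_cons, mul_left_comm, coeff_geomSeries_mul (h w (by simp)),
      weightCount]
    push_cast
    exact Finset.sum_congr rfl fun a _ => ih (fun v hv => h v (by simp [hv])) _

/-- The generating function of the partitions with parts in `{2, …, k + 1}`. -/
noncomputable def partSeries (k : ℕ) : PowerSeries ℝ := ∏ i ∈ Finset.range k, geomSeries (i + 2)

theorem coeff_geomSeries_mul_nonneg (w : ℕ) {P : PowerSeries ℝ} (hP : ∀ j, 0 ≤ coeff j P) (j : ℕ) :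
    0 ≤ coeff j (geomSeries w * P) := by
  rw [coeff_mul]
  refine Finset.sum_nonneg fun p _ => mul_nonneg ?_ (hP _)
  rw [geomSeries, coeff_mk]
  split_ifs <;> norm_num

theorem coeff_partSeries_nonneg (k j : ℕ) : 0 ≤ coeff j (partSeries k) := by
  induction k generalizing j with
  | zero =>
    rw [partSeries, Finset.prod_range_zero, coeff_one]
    split_ifs <;> norm_num
  | succ k ih =>
    rw [partSeries, Finset.prod_range_succ, mul_comm]
    exact coeff_geomSeries_mul_nonneg _ ih j

/-- From R = P + X^w R: truncating the shifted series only loses nonnegative terms. Partial sums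
make convergence irrelevant. -/
theorem sum_coeff_geomSeries_mul_le {w : ℕ} (hw : 1 ≤ w) {P : PowerSeries ℝ}
    (hP : ∀ j, 0 ≤ coeff j P) {y : ℝ} (hy : 0 ≤ y) (M : ℕ) :
    (1 - y ^ w) * ∑ j ∈ Finset.range M, coeff j (geomSeries w * P) * y ^ j ≤
      ∑ j ∈ Finset.range M, coeff j P * y ^ j := by
  set R := geomSeries w * P with hR
  have h : R = P + X ^ w * R := by
    rw [hR]
    conv_lhs => rw [geomSeries_eq hw]
    ring
  have hR0 : ∀ j, 0 ≤ coeff j R := coeff_geomSeries_mul_nonneg w hP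
  have hsum : ∑ j ∈ Finset.range M, coeff j R * y ^ j = ∑ j ∈ Finset.range M, coeff j P * y ^ j +
      ∑ j ∈ Finset.range M, coeff j (X ^ w * R) * y ^ j := by
    rw [← Finset.sum_add_distrib]
    refine Finset.sum_congr rfl fun j _ => ?_
    rw [← add_mul, ← map_add, ← h]
  have hshift : ∑ j ∈ Finset.range M, coeff j (X ^ w * R) * y ^ j ≤
      y ^ w * ∑ j ∈ Finset.range M, coeff j R * y ^ j := by
    calc ∑ j ∈ Finset.range M, coeff j (X ^ w * R) * y ^ j
        ≤ ∑ j ∈ Finset.range (w + M), coeff j (X ^ w * R) * y ^ j := by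
          refine Finset.sum_le_sum_of_subset_of_nonneg (Finset.range_mono (by omega)) ?_
          intro j _ _
          refine mul_nonneg ?_ (pow_nonneg hy j)
          rw [coeff_X_pow_mul']
          split_ifs
          exacts [hR0 _, le_rfl]
      _ = y ^ w * ∑ j ∈ Finset.range M, coeff j R * y ^ j := by
          rw [Finset.sum_range_add, Finset.sum_eq_zero, zero_add, Finset.mul_sum]
          · refine Finset.sum_congr rfl fun j _ => ?_
            rw [coeff_X_pow_mul', if_pos (by omega), Nat.add_sub_cancel_left, pow_add]
            ring
          · intro j hj
            rw [coeff_X_pow_mul', if_neg (by rw [Finset.mem_range] at hj; omega), zero_mul]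
  linarith

theorem prod_mul_sum_coeff_partSeries_le {y : ℝ} (hy : 0 ≤ y) (hy1 : y ≤ 1) (k M : ℕ) :
    (∏ i ∈ Finset.range k, (1 - y ^ (i + 2))) *
      ∑ j ∈ Finset.range M, coeff j (partSeries k) * y ^ j ≤ 1 := by
  induction k with
  | zero =>
    rw [Finset.prod_range_zero, one_mul, partSeries, Finset.prod_range_zero]
    simp only [coeff_one, ite_mul, one_mul, zero_mul, Finset.sum_ite_eq', Finset.mem_range]
    split_ifs <;> simp
  | succ k ih =>
    refine le_trans ?_ ih
    rw [Finset.prod_range_succ, mul_assoc, partSeries, Finset.prod_range_succ,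
      mul_comm _ (geomSeries (k + 2))]
    refine mul_le_mul_of_nonneg_left ?_ (Finset.prod_nonneg fun i _ =>
      sub_nonneg.2 (pow_le_one₀ hy hy1))
    exact sum_coeff_geomSeries_mul_le (by omega) (coeff_partSeries_nonneg k) hy M

theorem prod_map_range_list (f : ℕ → PowerSeries ℝ) (n : ℕ) :
    ((List.range n).map f).prod = ∏ i ∈ Finset.range n, f i := by
  induction n with
  | zero => simp
  | succ n ih => rw [List.range_succ, Finset.prod_range_succ]; simp [ih]

theorem coeff_geomSeries_one_pow (d m : ℕ) :
    coeff m (geomSeries 1 ^ (d + 1)) = ((d + m).choose d : ℝ) := by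
  have h : geomSeries 1 = mk 1 := by ext n; simp [geomSeries]
  rw [h, mk_one_pow_eq_mk_choose_add, coeff_mk]

/-- The list holds n - k ones, then 2, …, k + 1. With the factor for "at most", the ones give (1 -
X)^-(n - k + 1), whose coefficient at k - j is the binomial. -/
theorem weightCount_map_range_eq {n k : ℕ} (hk : k < n) :
    (weightCount ((List.range n).map fun i => max 1 (i + 1 + (k + 1) - n)) k : ℝ) =
      ∑ j ∈ Finset.range (k + 1), coeff j (partSeries k) * ((n - j).choose (n - k) : ℝ) := by
  rw [weightCount_eq_coeff (by simp)]
  have hprod : (((List.range n).map fun i => max 1 (i + 1 + (k + 1) - n)).map geomSeries).prod =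
      geomSeries 1 ^ (n - k) * partSeries k := by
    obtain ⟨d, rfl⟩ : ∃ d, n = d + (k + 1) := ⟨n - (k + 1), by omega⟩
    rw [List.map_map, prod_map_range_list, Finset.prod_range_add, Finset.prod_congr rfl
      (g := fun _ => geomSeries 1), Finset.prod_const, Finset.card_range, Finset.prod_range_succ',
      Finset.prod_congr rfl (g := fun i => geomSeries (i + 2))]
    · have h1 : d + (k + 1) - k = d + 1 := by omega
      have h2 : max 1 (d + 0 + 1 + (k + 1) - (d + (k + 1))) = 1 := by omega
      rw [Function.comp_apply, h1, h2, partSeries]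
      ring
    · intro i _
      rw [Function.comp_apply]
      congr 1
      omega
    · intro i hi
      rw [Finset.mem_range] at hi
      rw [Function.comp_apply]
      congr 1
      omega
  rw [hprod, ← mul_assoc, ← pow_succ', mul_comm, coeff_mul,
    Finset.Nat.sum_antidiagonal_eq_sum_range_succ_mk]
  refine Finset.sum_congr rfl fun j hj => ?_
  rw [Finset.mem_range] at hj
  simp only
  rw [coeff_geomSeries_one_pow, show n - k + (k - j) = n - j by omega]

end Counting

/-! ### Numerical estimates -/

section Estimates

theorem centralBinom_sq_mul_le (l : ℕ) : l.centralBinom ^ 2 * (3 * l + 1) ≤ 16 ^ l := by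
  induction l with
  | zero => simp
  | succ l ih =>
    have h := Nat.succ_mul_centralBinom_succ l
    have h2 : (l + 1) ^ 2 * ((l + 1).centralBinom ^ 2 * (3 * (l + 1) + 1)) ≤
        (l + 1) ^ 2 * 16 ^ (l + 1) := by
      calc (l + 1) ^ 2 * ((l + 1).centralBinom ^ 2 * (3 * (l + 1) + 1))
          = ((l + 1) * (l + 1).centralBinom) ^ 2 * (3 * (l + 1) + 1) := by ring
        _ = l.centralBinom ^ 2 * (4 * (2 * l + 1) ^ 2 * (3 * l + 4)) := by rw [h]; ring
        _ ≤ l.centralBinom ^ 2 * (16 * (l + 1) ^ 2 * (3 * l + 1)) := by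
          refine Nat.mul_le_mul_left _ ?_
          nlinarith
        _ = 16 * (l + 1) ^ 2 * (l.centralBinom ^ 2 * (3 * l + 1)) := by ring
        _ ≤ 16 * (l + 1) ^ 2 * 16 ^ l := Nat.mul_le_mul_left _ ih
        _ = (l + 1) ^ 2 * 16 ^ (l + 1) := by ring
    exact Nat.le_of_mul_le_mul_left h2 (by positivity)

theorem choose_sq_mul_le (m r : ℕ) : m.choose r ^ 2 * (3 * m + 2) ≤ 2 * 4 ^ m := by
  rcases Nat.even_or_odd' m with ⟨l, rfl | rfl⟩
  · have h1 := Nat.choose_le_centralBinom r l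
    have h2 := centralBinom_sq_mul_le l
    calc (2 * l).choose r ^ 2 * (3 * (2 * l) + 2)
        ≤ l.centralBinom ^ 2 * (3 * (2 * l) + 2) :=
          Nat.mul_le_mul_right _ (Nat.pow_le_pow_left h1 2)
      _ = 2 * (l.centralBinom ^ 2 * (3 * l + 1)) := by ring
      _ ≤ 2 * 16 ^ l := Nat.mul_le_mul_left _ h2
      _ = 2 * 4 ^ (2 * l) := by rw [pow_mul]; norm_num
  · have h0 := Nat.choose_le_middle r (2 * l + 1)
    rw [show (2 * l + 1) / 2 = l by omega] at h0
    have h1 : 2 * (2 * l + 1).choose l = (l + 1).centralBinom := by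
      rw [Nat.centralBinom, show 2 * (l + 1) = 2 * l + 1 + 1 by ring, Nat.choose_succ_succ,
        Nat.choose_symm_half]
      ring
    have h2 := centralBinom_sq_mul_le (l + 1)
    rw [← h1] at h2
    have h3 : (2 * l + 1).choose l ^ 2 * (3 * (2 * l + 1) + 2) * 2 ≤ 2 * 4 ^ (2 * l + 1) * 2 := by
      calc (2 * l + 1).choose l ^ 2 * (3 * (2 * l + 1) + 2) * 2
          ≤ (2 * (2 * l + 1).choose l) ^ 2 * (3 * (l + 1) + 1) := by
            rw [mul_pow, mul_assoc, mul_comm (2 ^ 2), mul_assoc]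
            exact Nat.mul_le_mul_left _ (by omega)
        _ ≤ 16 ^ (l + 1) := h2
        _ = 2 * 4 ^ (2 * l + 1) * 2 := by rw [pow_succ 4 (2 * l), pow_mul]; norm_num; ring
    exact (Nat.mul_le_mul_right _ (Nat.pow_le_pow_left h0 2)).trans
      (Nat.le_of_mul_le_mul_right h3 two_pos)

/-- From j = 2 on, the right side grows by at least (13/36)(9/5) = 13/20 > 3/5 per step; j = 1 is
checked apart. -/
theorem three_fifths_mul_succ_le_pow (j : ℕ) (hj : 1 ≤ j) : (3 / 5 : ℝ) * (j + 1) ≤ (49 / 36) ^ j := by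
  rcases hj.eq_or_lt with rfl | hj
  · norm_num
  · induction j, hj using Nat.le_induction with
    | base => norm_num
    | succ j hj2 ih =>
      have ih' := ih (by omega)
      have : (2 : ℝ) ≤ j := by exact_mod_cast hj2
      rw [pow_succ]
      push_cast
      linarith

/-- The factor 3/5 is dictated by n = j + 1, where the claim reads 3(j + 1) ≤ 5 (49/36)^j. -/
theorem mul_three_le_pow_mul {n j : ℕ} (hj : j < n) :
    (n : ℝ) * 3 ≤ (49 / 36) ^ j * (3 * ((n - j : ℕ) : ℝ) + 2) := by
  obtain ⟨e, rfl⟩ : ∃ e, n = j + (e + 1) := ⟨n - j - 1, by omega⟩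
  rw [Nat.add_sub_cancel_left]
  push_cast
  rcases Nat.eq_zero_or_pos j with rfl | h
  · norm_num
    linarith
  · have h1 := three_fifths_mul_succ_le_pow j h
    have h2 : (1 : ℝ) ≤ j := by exact_mod_cast h
    have h3 : (0 : ℝ) ≤ e := Nat.cast_nonneg e
    have h4 := mul_le_mul_of_nonneg_right h1 (by positivity : 0 ≤ 3 * ((e : ℝ) + 1) + 2)
    refine le_trans ?_ h4
    nlinarith

/-- Here 0.8165 exceeds √(2/3), and 7/12 = (1/2)(7/6): the 1/2 comes from 2^(n - j), while (7/6)^j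
absorbs replacing n - j by n under the root. -/
theorem choose_mul_sqrt_le {n j : ℕ} (hj : j < n) (r : ℕ) :
    ((n - j).choose r : ℝ) * Real.sqrt n ≤ 8165 / 10000 * 2 ^ n * (7 / 12) ^ j := by
  refine le_of_sq_le_sq ?_ (by positivity)
  rw [mul_pow, Real.sq_sqrt (Nat.cast_nonneg n)]
  have h1 : ((n - j).choose r : ℝ) ^ 2 * (3 * ((n - j : ℕ) : ℝ) + 2) ≤ 2 * 4 ^ (n - j) := by
    exact_mod_cast choose_sq_mul_le (n - j) r
  have h2 := mul_three_le_pow_mul hj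
  have h3 : (4 : ℝ) ^ (n - j) * 4 ^ j = 4 ^ n := by rw [← pow_add]; congr 1; omega
  have h4 : (8165 / 10000 * 2 ^ n * (7 / 12) ^ j : ℝ) ^ 2 =
      (8165 / 10000) ^ 2 * 4 ^ (n - j) * (49 / 36) ^ j := by
    have h5 : (8165 / 10000 * 2 ^ n * (7 / 12) ^ j : ℝ) ^ 2 =
        (8165 / 10000) ^ 2 * (2 ^ 2) ^ n * ((7 / 12) ^ 2) ^ j := by
      rw [mul_pow, mul_pow, pow_right_comm 2, pow_right_comm (7 / 12)]
    have h6 : ((7 / 12 : ℝ) ^ 2) ^ j * 4 ^ j = (49 / 36) ^ j := by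
      rw [← mul_pow]; norm_num
    rw [h5, ← h6, show (2 : ℝ) ^ 2 = 4 by norm_num, ← h3]
    ring
  rw [h4]
  have h5 := mul_le_mul_of_nonneg_left h2 (sq_nonneg ((n - j).choose r : ℝ))
  have h6 := mul_le_mul_of_nonneg_left h1 (by positivity : (0 : ℝ) ≤ (49 / 36) ^ j)
  have h7 : (0 : ℝ) ≤ 4 ^ (n - j) * (49 / 36) ^ j := by positivity
  nlinarith

theorem prod_one_sub_pow_ge (k : ℕ) :
    (10 / 27 : ℝ) ≤ ∏ i ∈ Finset.range k, (1 - (7 / 12 : ℝ) ^ (i + 2)) := by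
  -- Two factors are kept exactly; for the others ∏ (1 - a_i) ≥ 1 - Σ a_i, a geometric sum with 12/5
  -- = 1 / (1 - 7/12).
  have key : ∀ k : ℕ, (1 - (7 / 12 : ℝ) ^ 2) * (1 - (7 / 12) ^ 3) *
      (1 - ((7 / 12) ^ 4 - (7 / 12) ^ (k + 4)) * (12 / 5)) ≤
        ∏ i ∈ Finset.range (k + 2), (1 - (7 / 12 : ℝ) ^ (i + 2)) := by
    intro k
    induction k with
    | zero => norm_num [Finset.prod_range_succ]
    | succ k ih =>
      rw [show k + 1 + 2 = (k + 2) + 1 by ring, Finset.prod_range_succ]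
      have he0 : (0 : ℝ) ≤ (7 / 12) ^ (k + 4) := by positivity
      have he1 : ((7 : ℝ) / 12) ^ (k + 4) ≤ (7 / 12) ^ 4 :=
        pow_le_pow_of_le_one (by norm_num) (by norm_num) (by omega)
      rw [show k + 2 + 2 = k + 4 by ring, show k + 1 + 4 = (k + 4) + 1 by ring, pow_succ _ (k + 4)]
      set e := ((7 : ℝ) / 12) ^ (k + 4)
      refine le_trans ?_ (mul_le_mul_of_nonneg_right ih (by norm_num at he1 ⊢; linarith))
      rw [mul_assoc _ _ (1 - e)]
      refine mul_le_mul_of_nonneg_left ?_ (by norm_num)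
      nlinarith [mul_nonneg he0 (sub_nonneg.2 he1)]
  rcases k with _ | _ | k
  · norm_num
  · norm_num
  · refine le_trans ?_ (key k)
    have : (0 : ℝ) ≤ (7 / 12) ^ (k + 4) := by positivity
    norm_num
    linarith

theorem sum_coeff_partSeries_le (k M : ℕ) :
    ∑ j ∈ Finset.range M, PowerSeries.coeff j (partSeries k) * (7 / 12 : ℝ) ^ j ≤ 27 / 10 := by
  have h1 := prod_mul_sum_coeff_partSeries_le (y := 7 / 12) (by norm_num) (by norm_num) k M
  have h2 := prod_one_sub_pow_ge k
  have h3 : 0 ≤ ∑ j ∈ Finset.range M, PowerSeries.coeff j (partSeries k) * (7 / 12 : ℝ) ^ j :=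
    Finset.sum_nonneg fun j _ => mul_nonneg (coeff_partSeries_nonneg k j) (by positivity)
  have h4 := mul_le_mul_of_nonneg_right h2 h3
  linarith

theorem two_mul_cube_le (n : ℕ) : 2 * n ^ 3 ≤ 4 ^ n := by
  rcases Nat.lt_or_ge n 2 with h | h
  · interval_cases n <;> norm_num
  · induction n, h using Nat.le_induction with
    | base => norm_num
    | succ n hn ih =>
      rw [pow_succ 4]
      nlinarith [mul_le_mul hn hn (by norm_num) (by omega)]

theorem mul_sqrt_le (n : ℕ) : (n : ℝ) * Real.sqrt n ≤ 7072 / 10000 * 2 ^ n := by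
  refine le_of_sq_le_sq ?_ (by positivity)
  rw [mul_pow, Real.sq_sqrt (Nat.cast_nonneg n), mul_pow, ← pow_mul, mul_comm n 2, pow_mul]
  have : (2 : ℝ) * n ^ 3 ≤ 4 ^ n := by exact_mod_cast two_mul_cube_le n
  norm_num
  nlinarith

theorem weightCount_add_lt {n k : ℕ} (hk : k < n) :
    ((weightCount ((List.range n).map fun i => max 1 (i + 1 + (k + 1) - n)) k + n : ℕ) : ℝ) <
      3 / Real.sqrt n * 2 ^ n := by
  have hs : 0 < Real.sqrt n := Real.sqrt_pos.2 (by exact_mod_cast (by omega : 0 < n))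
  rw [div_mul_eq_mul_div, lt_div_iff₀ hs]
  push_cast
  rw [weightCount_map_range_eq hk, add_mul, Finset.sum_mul]
  have h1 : ∑ j ∈ Finset.range (k + 1), PowerSeries.coeff j (partSeries k) *
      ((n - j).choose (n - k) : ℝ) * Real.sqrt n ≤ 8165 / 10000 * 2 ^ n * (27 / 10) := by
    refine le_trans ?_ (mul_le_mul_of_nonneg_left (sum_coeff_partSeries_le k (k + 1))
      (by positivity))
    rw [Finset.mul_sum]
    refine Finset.sum_le_sum fun j hj => ?_
    rw [Finset.mem_range] at hj
    have := mul_le_mul_of_nonneg_left (choose_mul_sqrt_le (by omega : j < n) (n - k))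
      (coeff_partSeries_nonneg k j)
    linarith
  have h2 := mul_sqrt_le n
  have h3 : (0 : ℝ) < 2 ^ n := by positivity
  linarith

end Estimates

/-! ### The bound for nilpotent Lie algebras -/

theorem exists_faithful_module_lt (K : Type u) (L : Type v) [Field K] [LieRing L] [LieAlgebra K L]
    [FiniteDimensional K L] [LieRing.IsNilpotent L] [Nontrivial L] :
    ∃ (M : Type u) (_ : AddCommGroup M) (_ : Module K M) (_ : LieRingModule L M)
      (_ : LieModule K L M), LieModule.IsFaithful K L M ∧ Module.Finite K M ∧
        (Module.finrank K M : ℝ) <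
          3 / Real.sqrt (Module.finrank K L : ℝ) * 2 ^ Module.finrank K L := by
  classical
  have hnil : ∃ k, LieModule.lowerCentralSeries K L L k = ⊥ :=
    LieModule.IsNilpotent.nilpotent K L L
  obtain ⟨κ, hκ⟩ : ∃ κ, Nat.find hnil = κ := ⟨_, rfl⟩
  have hbot : LieModule.lowerCentralSeries K L L κ = ⊥ := hκ ▸ Nat.find_spec hnil
  obtain ⟨k, rfl⟩ : ∃ k, κ = k + 1 := by
    refine Nat.exists_eq_succ_of_ne_zero ?_
    rintro rfl
    rw [LieModule.lowerCentralSeries_zero] at hbot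
    exact top_ne_bot hbot
  have hne : LieModule.lowerCentralSeries K L L k ≠ ⊥ := Nat.find_min hnil (by omega)
  have hrank := le_finrank_lowerCentralSeries hbot hne
  obtain ⟨ws, hlen, hsort, h1, hcount, M, i1, i2, i3, i4, hM1, hM2, hM3⟩ :=
    exists_faithful_module (isLieFiltration_lowerCentralSeries hbot)
  refine ⟨M, i1, i2, i3, i4, hM1, hM2, ?_⟩
  have hk : k < Module.finrank K L := by
    have := (hrank 0).trans (Submodule.finrank_le
      (LieModule.lowerCentralSeries K L L 0).toSubmodule)
    omega
  -- Lowering the weights to 1, …, 1, 2, …, k + 1 only increases the number of monomials.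
  have hle := weightCount_le_of_forall₂ (forall₂_of_countP hsort h1 (k := k + 1) (fun j hj => by
    have := (hrank (j - 1)).trans (hcount j)
    omega)) k
  rw [hlen] at hle
  refine lt_of_le_of_lt ?_ (weightCount_add_lt hk)
  exact_mod_cast hM3.trans (Nat.add_le_add_right hle _)

theorem mainTheorem3 (K : Type u) (L : Type v) [Field K] [CharZero K] [LieRing L] [LieAlgebra K L]
    [FiniteDimensional K L] [LieRing.IsNilpotent L] (n : ℕ) (hn : 1 ≤ n)
    (hdim : Module.finrank K L = n) :
    (∃ (M : Type u) (_ : AddCommGroup M) (_ : Module K M) (_ : LieRingModule L M)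
        (_ : LieModule K L M),
        LieModule.IsFaithful K L M ∧ Module.Finite K M ∧
          (Module.finrank K M : ℝ) < 3 / Real.sqrt (n : ℝ) * 2 ^ n) ∧
      (faithfulMu K L : ℝ) < 3 / Real.sqrt (n : ℝ) * 2 ^ n := by
  subst hdim
  have : Nontrivial L := Module.nontrivial_of_finrank_pos (R := K) hn
  obtain ⟨M, i1, i2, i3, i4, h1, h2, h3⟩ := exists_faithful_module_lt K L
  refine ⟨⟨M, i1, i2, i3, i4, h1, h2, h3⟩, lt_of_le_of_lt ?_ h3⟩
  have : faithfulMu K L ≤ Module.finrank K M := Nat.sInf_le ⟨M, i1, i2, i3, i4, h1, h2, rfl⟩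
  exact_mod_cast this
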